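/- Let $1\le k\le n$ and $1\le r\le k$, let $f:\mathbb R^{n\times k}\to\mathbb R$ be twice continuously differentiable, and let $V\in\mathbb R^{k\times r}$ satisfy $\|V\|_F=1$ and $[VV^\top]_{ij}>0$ for all $i,j$. Write $\langle A,B\rangle=\mathrm{tr}(A^\top B)$, $x_j,d_j$ for the $j$-th columns of $X,D$, $\mathrm{Diag}(Z)$ for the diagonal matrix with the main diagonal of $Z$, and $$\mathcal{OB}^{n,k}_+=\{X\in\mathbb R^{n\times k}: X\ge 0,\ \|x_j\|=1\ \forall j\},\qquad \mathcal S^{n,k}_+=\{X\in\mathbb R^{n\times k}: X\ge 0,\ X^\top X=I_k\}.$$ For a function $h$ on $\mathbb R^{n\times k}$ let $\mathrm{grad}\,h(X)=\nabla h(X)-X\,\mathrm{Diag}(X^\top\nabla h(X))$ and $\mathrm{Hess}\,h(X)[D]=\nabla^2h(X)[D]-D\,\mathrm{Diag}(X^\top\nabla h(X))$. A point $X\in\mathcal{OB}^{n,k}_+$ satisfies the weak second-order optimality conditions (WSOC) for $\min_{\mathcal{OB}^{n,k}_+}h$ if $\min(X,\mathrm{grad}\,h(X))=0$ componentwise and $\langle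 D,\mathrm{Hess}\,h(X)[D]\rangle\ge 0$ for every $D\in\mathbb R^{n\times k}$ with $x_j^\top d_j=0$ for all $j$ and $D_{ij}=0$ whenever $X_{ij}=0$. The reformulated problem is $\min f(X)$ subject to $X\in\mathcal{OB}^{n,k}_+$, $\|XV\|_F=1$. A feasible point $X$ is a stationary point of it if $-\nabla f(X)$ lies in the polar of the linearized cone, i.e. $\langle\nabla f(X),D\rangle\ge 0$ for every $D$ with $x_j^\top d_j=0$ for all $j$, $D_{ij}\ge 0$ whenever $X_{ij}=0$, and $\langle D,XVV^\top\rangle=0$. The penalty function is $P_{\sigma,p,q,\epsilon}(X)=f(X)+\sigma\left(\|XV\|_F^q-1+\epsilon\right)^p$. Algorithm. Choose $X^0\in\mathcal{OB}^{n,k}_+$, $X^{\mathrm{feas}}\in\mathcal S^{n,k}_+$, $\sigma_0>0$, $p,q>0$, tolerances $\mathrm{tol}^{\mathrm{feas}},\varepsilon^{\mathrm{grad}}_0,\varepsilon^{\mathrm{grad}}_{\min}\in[0,1)$, an iteration limit $t_{\max}\in\{1,2,\dots\}\cup\{\infty\}$, and $\gamma_2>1$; let $\epsilon_0>0$, $\gamma_1\in(0,\gamma_2^{-1/p})$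 if $p<1$, and $\epsilon_0=0$, $\gamma_1=1$ if $p\ge 1$; let $\eta\in(0,\gamma_2^{-1}\gamma_1^{1-p})$ and $X^{0,0}=X^0$. For $t=0,1,2,\dots,t_{\max}$: if $P_{\sigma_t,p,q,\epsilon_t}(X^{t,0})>P_{\sigma_t,p,q,\epsilon_t}(X^{\mathrm{feas}})$, reset $X^{t,0}=X^{\mathrm{feas}}$; find $X^t\in\mathcal{OB}^{n,k}_+$ with $$\|\min(X^t,\mathrm{grad}\,P_{\sigma_t,p,q,\epsilon_t}(X^t))\|_F\le\varepsilon^{\mathrm{grad}}_t,\qquad P_{\sigma_t,p,q,\epsilon_t}(X^t)\le P_{\sigma_t,p,q,\epsilon_t}(X^{t,0});$$ stop if $\|X^tV\|_F^2-1\le\mathrm{tol}^{\mathrm{feas}}$; otherwise set $\epsilon_{t+1}=\gamma_1\epsilon_t$, $\sigma_{t+1}=\gamma_2\sigma_t$, $\varepsilon^{\mathrm{grad}}_{t+1}=\max\{\eta\varepsilon^{\mathrm{grad}}_t,\varepsilon^{\mathrm{grad}}_{\min}\}$, $X^{t+1,0}=X^t$. Theorem. Let $X^t$ be a sequence generated by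 this algorithm with $t_{\max}=\infty$, $\mathrm{tol}^{\mathrm{feas}}=0$, $p\le 1$ and $\varepsilon^{\mathrm{grad}}_0=\varepsilon^{\mathrm{grad}}_{\min}=0$. If every iterate $X^t$ satisfies the WSOC of the subproblem $\min_{X\in\mathcal{OB}^{n,k}_+}P_{\sigma_t,p,q,\epsilon_t}(X)$, then the algorithm stops at some finite iteration $\tilde t$, and $X^{\tilde t}$ is a stationary point of the reformulated problem. -/

import Mathlib

open scoped Matrix Matrix.Norms.Frobenius

/-! Throughout, `‖·‖` on matrices is the Frobenius norm. -/

namespace EP4Orth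

variable {n k r : ℕ}

/-- The trace inner product `⟨A, B⟩ = tr(Aᵀ B)`. -/
def inn (A B : Matrix (Fin n) (Fin k) ℝ) : ℝ := (Aᵀ * B).trace

/-- `Diag(Z)`: the diagonal matrix with the same main diagonal as `Z`. -/
def diagPart (Z : Matrix (Fin k) (Fin k) ℝ) : Matrix (Fin k) (Fin k) ℝ :=
  Matrix.diagonal Z.diag

/-- `OB₊^{n,k}`: the matrices with nonnegative entries and unit Euclidean columns. -/
def obliquePlus (n k : ℕ) : Set (Matrix (Fin n) (Fin k) ℝ) :=
  {X | (∀ j, X.col j ⬝ᵥ X.col j = 1) ∧ ∀ i j, 0 ≤ X i j}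

/-- `S₊^{n,k}`: the matrices with orthonormal columns and nonnegative entries. -/
def stiefelPlus (n k : ℕ) : Set (Matrix (Fin n) (Fin k) ℝ) :=
  {X | Xᵀ * X = 1 ∧ ∀ i j, 0 ≤ X i j}

/-- The conditions on the constant matrix `V`: `‖V‖ = 1` and all entries of `V Vᵀ` are positive. -/
def AdmissibleV (V : Matrix (Fin k) (Fin r) ℝ) : Prop :=
  ‖V‖ = 1 ∧ ∀ i j, 0 < (V * Vᵀ) i j

/-- The feasible set `X_V = {X ∈ OB₊^{n,k} : ‖X V‖ = 1}` of the reformulated problem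
`min f(X)` subject to `X ∈ OB₊^{n,k}`, `‖X V‖ = 1`. -/
def feasibleSet (n : ℕ) (V : Matrix (Fin k) (Fin r) ℝ) : Set (Matrix (Fin n) (Fin k) ℝ) :=
  {X | X ∈ obliquePlus n k ∧ ‖X * V‖ = 1}

/-- The Euclidean gradient `∇h(X)`, the matrix of partial derivatives of `h`. -/
noncomputable def egrad (h : Matrix (Fin n) (Fin k) ℝ → ℝ) (X : Matrix (Fin n) (Fin k) ℝ) :
    Matrix (Fin n) (Fin k) ℝ :=
  Matrix.of fun i j => fderiv ℝ h X (Matrix.single i j 1)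

/-- The Euclidean Hessian `∇²h(X)[D]`, the derivative of `∇h` at `X` in the direction `D`. -/
noncomputable def ehess (h : Matrix (Fin n) (Fin k) ℝ → ℝ) (X D : Matrix (Fin n) (Fin k) ℝ) :
    Matrix (Fin n) (Fin k) ℝ :=
  fderiv ℝ (egrad h) X D

/-- The Riemannian gradient on the oblique manifold,
`grad h(X) = ∇h(X) - X Diag(Xᵀ ∇h(X))`. -/
noncomputable def rgrad (h : Matrix (Fin n) (Fin k) ℝ → ℝ) (X : Matrix (Fin n) (Fin k) ℝ) :
    Matrix (Fin n) (Fin k) ℝ :=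
  egrad h X - X * diagPart (Xᵀ * egrad h X)

/-- The Riemannian Hessian on the oblique manifold,
`Hess h(X)[D] = ∇²h(X)[D] - D Diag(Xᵀ ∇h(X))`. -/
noncomputable def rhess (h : Matrix (Fin n) (Fin k) ℝ → ℝ) (X D : Matrix (Fin n) (Fin k) ℝ) :
    Matrix (Fin n) (Fin k) ℝ :=
  ehess h X D - D * diagPart (Xᵀ * egrad h X)

/-- The componentwise minimum `min(A, B)`. -/
noncomputable def minMat (A B : Matrix (Fin n) (Fin k) ℝ) : Matrix (Fin n) (Fin k) ℝ :=
  Matrix.of fun i j => min (A i j) (B i j)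

/-- The linearized cone of `X_V` at `X`. -/
def linCone (V : Matrix (Fin k) (Fin r) ℝ) (X : Matrix (Fin n) (Fin k) ℝ) :
    Set (Matrix (Fin n) (Fin k) ℝ) :=
  {D | (∀ j, X.col j ⬝ᵥ D.col j = 0) ∧ (∀ i j, X i j = 0 → 0 ≤ D i j) ∧
    inn D (X * V * Vᵀ) = 0}

/-- The polar cone. -/
def polarCone (C : Set (Matrix (Fin n) (Fin k) ℝ)) : Set (Matrix (Fin n) (Fin k) ℝ) :=
  {W | ∀ D ∈ C, inn W D ≤ 0}

/-- `X` is a stationary point of the reformulated problem: it is feasible and `-∇f(X)` lies in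
the polar of the linearized cone at `X`. -/
def IsStationary (f : Matrix (Fin n) (Fin k) ℝ → ℝ) (V : Matrix (Fin k) (Fin r) ℝ)
    (X : Matrix (Fin n) (Fin k) ℝ) : Prop :=
  X ∈ feasibleSet n V ∧ -egrad f X ∈ polarCone (linCone V X)

/-- The weak second-order optimality conditions at `X` for `min h` over `OB₊^{n,k}`. -/
def WSOC (h : Matrix (Fin n) (Fin k) ℝ → ℝ) (X : Matrix (Fin n) (Fin k) ℝ) : Prop :=
  X ∈ obliquePlus n k ∧ minMat X (rgrad h X) = 0 ∧
    ∀ D : Matrix (Fin n) (Fin k) ℝ, (∀ j, X.col j ⬝ᵥ D.col j = 0) →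
      (∀ i j, X i j = 0 → D i j = 0) → 0 ≤ inn D (rhess h X D)

/-- The penalty function `P_{σ,p,q,ε}(X) = f(X) + σ (‖X V‖^q - 1 + ε)^p`. -/
noncomputable def penalty (f : Matrix (Fin n) (Fin k) ℝ → ℝ) (V : Matrix (Fin k) (Fin r) ℝ)
    (σ p q ε : ℝ) (X : Matrix (Fin n) (Fin k) ℝ) : ℝ :=
  f X + σ * (‖X * V‖ ^ q - 1 + ε) ^ p

/-- The input data of the exact penalty algorithm: the initial point `X⁰`, the feasible point
`X^feas`, and the scalar parameters. -/
structure Params (n k : ℕ) where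
  Xinit : Matrix (Fin n) (Fin k) ℝ
  Xfeas : Matrix (Fin n) (Fin k) ℝ
  σ₀ : ℝ
  p : ℝ
  q : ℝ
  tolFeas : ℝ
  εgrad₀ : ℝ
  εgradMin : ℝ
  tMax : ℕ∞
  γ₁ : ℝ
  γ₂ : ℝ
  ε₀ : ℝ
  η : ℝ

/-- The requirements of the initialization step. -/
structure Params.Valid (a : Params n k) : Prop where
  Xinit_mem : a.Xinit ∈ obliquePlus n k
  Xfeas_mem : a.Xfeas ∈ stiefelPlus n k
  σ₀_pos : 0 < a.σ₀
  p_pos : 0 < a.p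
  q_pos : 0 < a.q
  tolFeas_mem : a.tolFeas ∈ Set.Ico (0 : ℝ) 1
  εgrad₀_mem : a.εgrad₀ ∈ Set.Ico (0 : ℝ) 1
  εgradMin_mem : a.εgradMin ∈ Set.Ico (0 : ℝ) 1
  tMax_pos : 0 < a.tMax
  one_lt_γ₂ : 1 < a.γ₂
  of_p_lt_one : a.p < 1 → 0 < a.ε₀ ∧ a.γ₁ ∈ Set.Ioo (0 : ℝ) (a.γ₂ ^ (-1 / a.p))
  of_one_le_p : 1 ≤ a.p → a.ε₀ = 0 ∧ a.γ₁ = 1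
  η_mem : a.η ∈ Set.Ioo (0 : ℝ) (a.γ₂⁻¹ * a.γ₁ ^ (1 - a.p))

namespace Params

/-- The penalty parameter `σ_t`: `σ_{t+1} = γ₂ σ_t`. -/
def σ (a : Params n k) : ℕ → ℝ
  | 0 => a.σ₀
  | t + 1 => a.γ₂ * a.σ t

/-- The smoothing parameter `ε_t`: `ε_{t+1} = γ₁ ε_t`. -/
def ε (a : Params n k) : ℕ → ℝ
  | 0 => a.ε₀
  | t + 1 => a.γ₁ * a.ε t

/-- The tolerance `ε_t^grad`: `ε_{t+1}^grad = max {η ε_t^grad, ε_min^grad}`. -/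
noncomputable def εgrad (a : Params n k) : ℕ → ℝ
  | 0 => a.εgrad₀
  | t + 1 => max (a.η * a.εgrad t) a.εgradMin

/-- The objective `P_{σ_t,p,q,ε_t}` of the `t`-th penalty subproblem. -/
noncomputable def P (a : Params n k) (f : Matrix (Fin n) (Fin k) ℝ → ℝ)
    (V : Matrix (Fin k) (Fin r) ℝ) (t : ℕ) : Matrix (Fin n) (Fin k) ℝ → ℝ :=
  penalty f V (a.σ t) a.p a.q (a.ε t)

/-- The candidate starting point of iteration `t`: `X⁰` for `t = 0`, and `X^{t-1}` afterwards. -/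
def warmStart (a : Params n k) (X : ℕ → Matrix (Fin n) (Fin k) ℝ) :
    ℕ → Matrix (Fin n) (Fin k) ℝ
  | 0 => a.Xinit
  | t + 1 => X t

open Classical in
/-- The starting point `X^{t,0}`: the candidate, replaced by `X^feas` if the candidate has a
larger value of `P_t`. -/
noncomputable def start (a : Params n k) (f : Matrix (Fin n) (Fin k) ℝ → ℝ)
    (V : Matrix (Fin k) (Fin r) ℝ) (X : ℕ → Matrix (Fin n) (Fin k) ℝ) (t : ℕ) :
    Matrix (Fin n) (Fin k) ℝ :=
  if a.P f V t a.Xfeas < a.P f V t (a.warmStart X t) then a.Xfeas else a.warmStart X t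

/-- The stopping test at the end of iteration `t`: `‖X^t V‖² - 1 ≤ tol^feas`. -/
def Stops (a : Params n k) (V : Matrix (Fin k) (Fin r) ℝ)
    (X : ℕ → Matrix (Fin n) (Fin k) ℝ) (t : ℕ) : Prop :=
  ‖X t * V‖ ^ 2 - 1 ≤ a.tolFeas

/-- Iteration `t` is executed: `t ≤ t_max` and no earlier iteration has passed the stopping
test. -/
def Executed (a : Params n k) (V : Matrix (Fin k) (Fin r) ℝ)
    (X : ℕ → Matrix (Fin n) (Fin k) ℝ) (t : ℕ) : Prop :=
  (t : ℕ∞) ≤ a.tMax ∧ ∀ s < t, ¬ a.Stops V X s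

/-- `X` is a sequence generated by the algorithm (the loop, without postprocessing): in each
executed iteration `t` the point `X^t ∈ OB₊^{n,k}` satisfies the approximate first-order condition
and the descent condition.  The values of `X` at iterations that are not executed are irrelevant. -/
def Generated (a : Params n k) (f : Matrix (Fin n) (Fin k) ℝ → ℝ)
    (V : Matrix (Fin k) (Fin r) ℝ) (X : ℕ → Matrix (Fin n) (Fin k) ℝ) : Prop :=
  ∀ t, a.Executed V X t →
    X t ∈ obliquePlus n k ∧
    ‖minMat (X t) (rgrad (a.P f V t) (X t))‖ ≤ a.εgrad t ∧
    a.P f V t (X t) ≤ a.P f V t (a.start f V X t)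

end Params

end EP4Orth

namespace EP4Orth

variable {n k r : ℕ}

/-! Write `M = V * Vᵀ` and `s = ‖X * V‖ ^ 2`. On `obliquePlus`, `s` is 1 plus weighted overlaps of
distinct columns, with positive weights, so `s ≥ 1`, with equality when the columns have disjoint
supports. The penalty term is a scalar function `pen` of the quadratic form `s`, and `β = σ * pen'`
acts as the effective penalty parameter.

The core is `exists_exactness_threshold`: if `β` is large and `s` is close to 1, WSOC forces `s ≤
1`. Otherwise some row `i` meets two columns `j`, `l`. By the first-order conditions
(`eq_zero_of_large_entry`), a row carrying a large entry of one column meets no other column. Hence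
large entries of columns `j` and `l` lie in two further rows, which can absorb an exchange of mass
in row `i`. Along this tangent direction the penalty contributes a term of order `-β` to the
second-order form, while the rest stays bounded (`curv_add_nonneg`), which is impossible for large
`β`.

If the algorithm never stopped, comparison with `Xfeas` and `σ_mul_ε_rpow_le` would bound the
penalty term, so `σ → ∞` would drive `s` to 1. Since `p ≤ 1`, `pen'` stays bounded below, so `β →
∞`, contradicting the threshold. At the stopping point `s = 1`, and the penalty gradient vanishes on
the linearized cone (`isStationary_of_wsoc`). -/

/-! ### Trace inner product and matrix gradients -/

theorem inn_eq_sum (A B : Matrix (Fin n) (Fin k) ℝ) :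
    inn A B = ∑ i, ∑ j, A i j * B i j := by
  simp only [inn, Matrix.trace, Matrix.diag, Matrix.mul_apply, Matrix.transpose_apply]
  exact Finset.sum_comm

theorem inn_comm (A B : Matrix (Fin n) (Fin k) ℝ) : inn A B = inn B A := by
  simp only [inn_eq_sum, mul_comm]

theorem inn_add_left (A B C : Matrix (Fin n) (Fin k) ℝ) :
    inn (A + B) C = inn A C + inn B C := by
  simp [inn, Matrix.add_mul]

theorem inn_smul_left (c : ℝ) (A C : Matrix (Fin n) (Fin k) ℝ) :
    inn (c • A) C = c * inn A C := by
  simp [inn]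

theorem inn_sub_left (A B C : Matrix (Fin n) (Fin k) ℝ) :
    inn (A - B) C = inn A C - inn B C := by
  simp [inn, Matrix.sub_mul]

theorem inn_neg_left (A C : Matrix (Fin n) (Fin k) ℝ) : inn (-A) C = -inn A C := by
  simp [inn]

theorem inn_single (A : Matrix (Fin n) (Fin k) ℝ) (i : Fin n) (j : Fin k) :
    inn A (Matrix.single i j 1) = A i j := by
  rw [inn_eq_sum, Finset.sum_eq_single i, Finset.sum_eq_single j]
  · simp
  · intro b _ hb
    simp [Matrix.single, hb.symm]
  · simp
  · intro b _ hb
    simp [Matrix.single, hb.symm]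
  · simp

/-- The trace inner product as a continuous bilinear map. -/
noncomputable def innL (n k : ℕ) :
    Matrix (Fin n) (Fin k) ℝ →L[ℝ] Matrix (Fin n) (Fin k) ℝ →L[ℝ] ℝ :=
  LinearMap.toContinuousLinearMap
    ((LinearMap.toContinuousLinearMap :
      (Matrix (Fin n) (Fin k) ℝ →ₗ[ℝ] ℝ) ≃ₗ[ℝ] _).toLinearMap ∘ₗ
      LinearMap.mk₂ ℝ inn inn_add_left inn_smul_left
        (fun A B C => by rw [inn_comm, inn_add_left, inn_comm B, inn_comm C])
        (fun c A B => by rw [inn_comm, inn_smul_left, inn_comm B, smul_eq_mul]))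

theorem innL_apply (A B : Matrix (Fin n) (Fin k) ℝ) : innL n k A B = inn A B := rfl

theorem continuous_inn :
    Continuous fun z : Matrix (Fin n) (Fin k) ℝ × Matrix (Fin n) (Fin k) ℝ => inn z.1 z.2 := by
  exact (innL n k).continuous₂

/-- Right multiplication by a fixed matrix as a continuous linear map. -/
noncomputable def mulRightL (n : ℕ) (M : Matrix (Fin k) (Fin k) ℝ) :
    Matrix (Fin n) (Fin k) ℝ →L[ℝ] Matrix (Fin n) (Fin k) ℝ :=
  LinearMap.toContinuousLinearMap
    { toFun := fun X => X * M
      map_add' := fun A B => Matrix.add_mul A B M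
      map_smul' := fun c A => Matrix.smul_mul c A M }

/-- The matrix representing a linear functional, depending linearly on the functional. -/
noncomputable def gradL (n k : ℕ) :
    (Matrix (Fin n) (Fin k) ℝ →L[ℝ] ℝ) →L[ℝ] Matrix (Fin n) (Fin k) ℝ :=
  LinearMap.toContinuousLinearMap
    { toFun := fun L => Matrix.of fun i j => L (Matrix.single i j 1)
      map_add' := fun A B => by ext; simp
      map_smul' := fun c A => by ext; simp }

theorem egrad_eq_gradL (h : Matrix (Fin n) (Fin k) ℝ → ℝ) :
    egrad h = fun X => gradL n k (fderiv ℝ h X) := rfl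

theorem egrad_eq_of_hasFDerivAt {h : Matrix (Fin n) (Fin k) ℝ → ℝ}
    {X A : Matrix (Fin n) (Fin k) ℝ} (hh : HasFDerivAt h (innL n k A) X) : egrad h X = A := by
  ext i j
  simp only [egrad, hh.fderiv, innL_apply, Matrix.of_apply, inn_single]

theorem hasFDerivAt_egrad {h : Matrix (Fin n) (Fin k) ℝ → ℝ} {X : Matrix (Fin n) (Fin k) ℝ}
    (hh : DifferentiableAt ℝ h X) : HasFDerivAt h (innL n k (egrad h X)) X := by
  convert hh.hasFDerivAt using 1
  ext D
  conv_rhs => rw [Matrix.matrix_eq_sum_single D]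
  rw [innL_apply, inn_eq_sum, map_sum]
  refine Finset.sum_congr rfl fun i _ => ?_
  rw [map_sum]
  refine Finset.sum_congr rfl fun j _ => ?_
  have : Matrix.single i j (D i j) = D i j • Matrix.single i j (1 : ℝ) := by simp
  rw [this, map_smul, smul_eq_mul, mul_comm]
  rfl

theorem contDiff_egrad {f : Matrix (Fin n) (Fin k) ℝ → ℝ} (hf : ContDiff ℝ 2 f) :
    ContDiff ℝ 1 (egrad f) := by
  rw [egrad_eq_gradL]
  exact (gradL n k).contDiff.comp (hf.fderiv_right (m := 1) (by norm_num))

theorem hasFDerivAt_inn_mul {M : Matrix (Fin k) (Fin k) ℝ} (hM : Mᵀ = M)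
    (X : Matrix (Fin n) (Fin k) ℝ) :
    HasFDerivAt (fun Y => inn Y (Y * M)) (innL n k ((2 : ℝ) • (X * M))) X := by
  have h := (innL n k).hasFDerivAt_of_bilinear (hasFDerivAt_id X) (mulRightL n M).hasFDerivAt
    (x := X)
  refine h.congr_fderiv ?_
  ext D
  have : inn X (D * M) = inn (X * M) D := by
    simp only [inn]
    rw [Matrix.transpose_mul, hM, ← Matrix.mul_assoc, Matrix.trace_mul_comm, Matrix.mul_assoc]
  change inn X (D * M) + inn D (X * M) = inn ((2 : ℝ) • (X * M)) D
  rw [this, inn_smul_left, inn_comm D]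
  ring

theorem norm_mul_sq (V : Matrix (Fin k) (Fin r) ℝ) (X : Matrix (Fin n) (Fin k) ℝ) :
    ‖X * V‖ ^ 2 = inn X (X * (V * Vᵀ)) := by
  have h1 : ‖X * V‖ ^ 2 = inn (X * V) (X * V) := by
    rw [Matrix.frobenius_norm_def, ← Real.sqrt_eq_rpow, Real.sq_sqrt (by positivity), inn_eq_sum]
    simp [sq]
  rw [h1]
  rw [inn, inn, Matrix.transpose_mul, Matrix.mul_assoc, Matrix.trace_mul_comm]
  simp only [Matrix.mul_assoc]

/-! ### The scalar penalty and its derivatives -/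

/-- The scalar function whose composition with `X ↦ ‖X V‖ ^ 2` is the penalty term. -/
noncomputable def pen (p q ε s : ℝ) : ℝ := (s ^ (q / 2) - 1 + ε) ^ p

/-- The derivative of `pen`. -/
noncomputable def pen' (p q ε s : ℝ) : ℝ :=
  q / 2 * s ^ (q / 2 - 1) * p * (s ^ (q / 2) - 1 + ε) ^ (p - 1)

/-- The second derivative of `pen`. -/
noncomputable def pen'' (p q ε s : ℝ) : ℝ :=
  q / 2 * ((q / 2 - 1) * s ^ (q / 2 - 2)) * p * (s ^ (q / 2) - 1 + ε) ^ (p - 1) +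
    q / 2 * s ^ (q / 2 - 1) * p *
      (q / 2 * s ^ (q / 2 - 1) * (p - 1) * (s ^ (q / 2) - 1 + ε) ^ (p - 2))

theorem hasDerivAt_pen_base {s : ℝ} (q ε : ℝ) (hs : 0 < s) :
    HasDerivAt (fun s : ℝ => s ^ (q / 2) - 1 + ε) (q / 2 * s ^ (q / 2 - 1)) s :=
  ((Real.hasDerivAt_rpow_const (Or.inl hs.ne')).sub_const 1).add_const ε

theorem hasDerivAt_pen {p q ε s : ℝ} (hs : 0 < s)
    (h : s ^ (q / 2) - 1 + ε ≠ 0 ∨ 1 ≤ p) : HasDerivAt (pen p q ε) (pen' p q ε s) s :=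
  (hasDerivAt_pen_base q ε hs).rpow_const h

theorem hasDerivAt_pen' {p q ε s : ℝ} (hs : 0 < s)
    (h : s ^ (q / 2) - 1 + ε ≠ 0) : HasDerivAt (pen' p q ε) (pen'' p q ε s) s := by
  have h1 : HasDerivAt (fun s : ℝ => s ^ (q / 2 - 1)) ((q / 2 - 1) * s ^ (q / 2 - 2)) s := by
    convert Real.hasDerivAt_rpow_const (p := q / 2 - 1) (Or.inl hs.ne') using 3
    ring
  have h2 := (hasDerivAt_pen_base q ε hs).rpow_const (p := p - 1) (Or.inl h)
  have h3 : p - 1 - 1 = p - 2 := by ring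
  rw [h3] at h2
  exact ((h1.const_mul (q / 2)).mul_const p).mul h2

theorem pen'_pos {p q ε s : ℝ} (hp : 0 < p) (hq : 0 < q) (hs : 0 < s)
    (h : 0 < s ^ (q / 2) - 1 + ε) : 0 < pen' p q ε s := by
  unfold pen'
  positivity

/-- The summand with factor `p - 1` is nonpositive because `p ≤ 1`, and `s ≥ 1` compares the two
powers of `s` in the other one. The possibly singular factor `(s ^ (q / 2) - 1 + ε) ^ (p - 1)` is
thus absorbed into `pen'`. -/
theorem pen''_le {p q ε s : ℝ} (hp : 0 < p) (hp1 : p ≤ 1) (hq : 0 < q) (hs : 1 ≤ s)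
    (h : 0 < s ^ (q / 2) - 1 + ε) : pen'' p q ε s ≤ q / 2 * pen' p q ε s := by
  have hs0 : 0 < s := by linarith
  unfold pen'' pen'
  have e : s ^ (q / 2 - 2) ≤ s ^ (q / 2 - 1) := Real.rpow_le_rpow_of_exponent_le hs (by linarith)
  have e0 : 0 < s ^ (q / 2 - 2) := by positivity
  set u := (s ^ (q / 2) - 1 + ε) ^ (p - 1) with hu
  have hu0 : 0 < u := by positivity
  have h1 : q / 2 * ((q / 2 - 1) * s ^ (q / 2 - 2)) * p * u ≤
      q / 2 * (q / 2 * s ^ (q / 2 - 1)) * p * u := by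
    gcongr
    nlinarith
  have h2 : q / 2 * s ^ (q / 2 - 1) * p *
      (q / 2 * s ^ (q / 2 - 1) * (p - 1) * (s ^ (q / 2) - 1 + ε) ^ (p - 2)) ≤ 0 := by
    apply mul_nonpos_of_nonneg_of_nonpos (by positivity)
    apply mul_nonpos_of_nonpos_of_nonneg _ (by positivity)
    exact mul_nonpos_of_nonneg_of_nonpos (by positivity) (by linarith)
  linarith

/-! ### Gradient and Hessian of the penalty function -/

theorem penalty_eq (f : Matrix (Fin n) (Fin k) ℝ → ℝ) (V : Matrix (Fin k) (Fin r) ℝ)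
    (σ p q ε : ℝ) :
    penalty f V σ p q ε = fun X => f X + σ * pen p q ε (inn X (X * (V * Vᵀ))) := by
  funext X
  rw [penalty, pen, ← norm_mul_sq, ← Real.rpow_natCast, ← Real.rpow_mul (norm_nonneg _)]
  norm_num [mul_div_cancel₀]

theorem transpose_gram (V : Matrix (Fin k) (Fin r) ℝ) : (V * Vᵀ)ᵀ = V * Vᵀ := by
  simp [Matrix.transpose_mul]

theorem egrad_penalty {f : Matrix (Fin n) (Fin k) ℝ → ℝ} (hf : ContDiff ℝ 2 f)
    (V : Matrix (Fin k) (Fin r) ℝ) (σ p q ε : ℝ) {X : Matrix (Fin n) (Fin k) ℝ}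
    (hs : 0 < inn X (X * (V * Vᵀ)))
    (h : inn X (X * (V * Vᵀ)) ^ (q / 2) - 1 + ε ≠ 0 ∨ 1 ≤ p) :
    egrad (penalty f V σ p q ε) X =
      egrad f X + (2 * (σ * pen' p q ε (inn X (X * (V * Vᵀ))))) • (X * (V * Vᵀ)) := by
  apply egrad_eq_of_hasFDerivAt
  rw [penalty_eq]
  have h1 := (hasFDerivAt_egrad ((hf.differentiable (by norm_num)) X)).add
    ((((hasDerivAt_pen hs h).comp_hasFDerivAt X
      (hasFDerivAt_inn_mul (transpose_gram V) X))).const_mul σ)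
  refine h1.congr_fderiv ?_
  ext D
  change inn (egrad f X) D + σ * (pen' p q ε (inn X (X * (V * Vᵀ))) *
    inn ((2 : ℝ) • (X * (V * Vᵀ))) D) = inn (egrad f X + _ • (X * (V * Vᵀ))) D
  rw [inn_add_left, inn_smul_left, inn_smul_left]
  ring

theorem ehess_penalty {f : Matrix (Fin n) (Fin k) ℝ → ℝ} (hf : ContDiff ℝ 2 f)
    (V : Matrix (Fin k) (Fin r) ℝ) (σ p q ε : ℝ) {X : Matrix (Fin n) (Fin k) ℝ}
    (hs : 0 < inn X (X * (V * Vᵀ)))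
    (h : inn X (X * (V * Vᵀ)) ^ (q / 2) - 1 + ε ≠ 0) (D : Matrix (Fin n) (Fin k) ℝ) :
    ehess (penalty f V σ p q ε) X D =
      ehess f X D + (4 * (σ * pen'' p q ε (inn X (X * (V * Vᵀ)))) * inn (X * (V * Vᵀ)) D) •
        (X * (V * Vᵀ)) +
      (2 * (σ * pen' p q ε (inn X (X * (V * Vᵀ))))) • (D * (V * Vᵀ)) := by
  set M := V * Vᵀ with hM
  have hG := hasFDerivAt_inn_mul (transpose_gram V) X
  -- Differentiating the gradient needs its formula on a neighbourhood; both side conditions are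
  -- open.
  have hev : egrad (penalty f V σ p q ε) =ᶠ[nhds X] fun Y =>
      egrad f Y + (2 * (σ * pen' p q ε (inn Y (Y * M)))) • (Y * M) := by
    have c1 : ContinuousAt (fun Y => inn Y (Y * M)) X := hG.continuousAt
    have c2 : ContinuousAt (fun Y => inn Y (Y * M) ^ (q / 2) - 1 + ε) X :=
      ((c1.rpow_const (Or.inl hs.ne')).sub continuousAt_const).add continuousAt_const
    filter_upwards [c1.eventually (lt_mem_nhds hs), c2.eventually_ne h] with Y h1 h2
    exact egrad_penalty hf V σ p q ε h1 (Or.inl h2)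
  have h1 : HasFDerivAt (egrad f) (fderiv ℝ (egrad f) X) X :=
    ((contDiff_egrad hf).differentiable (by norm_num) X).hasFDerivAt
  have h2 := (((hasDerivAt_pen' (p := p) hs h).comp_hasFDerivAt X hG).const_mul σ).const_mul 2
  have h3 := h1.add (h2.smul (mulRightL n M).hasFDerivAt)
  rw [ehess, hev.fderiv_eq]
  erw [h3.fderiv]
  change ehess f X D + ((2 * (σ * pen' p q ε (inn X (X * M)))) • (D * M) +
    (2 * (σ * (pen'' p q ε (inn X (X * M)) * inn ((2 : ℝ) • (X * M)) D))) • (X * M)) = _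
  rw [inn_smul_left, add_assoc, add_comm (_ • (D * M))]
  congr 3
  ring

/-! ### Geometry of `obliquePlus` and column overlaps -/

theorem col_dotProduct_col (X D : Matrix (Fin n) (Fin k) ℝ) (j : Fin k) :
    X.col j ⬝ᵥ D.col j = ∑ i, X i j * D i j := rfl

theorem mul_diagPart_apply (D : Matrix (Fin n) (Fin k) ℝ) (Z : Matrix (Fin k) (Fin k) ℝ)
    (i : Fin n) (j : Fin k) : (D * diagPart Z) i j = D i j * Z j j := by
  simp [diagPart, Matrix.mul_diagonal]

theorem sum_sq_of_mem {X : Matrix (Fin n) (Fin k) ℝ} (hX : X ∈ obliquePlus n k) (j : Fin k) :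
    ∑ i, X i j * X i j = 1 := hX.1 j

theorem entry_le_one {X : Matrix (Fin n) (Fin k) ℝ} (hX : X ∈ obliquePlus n k) (i : Fin n)
    (j : Fin k) : X i j ≤ 1 := by
  have h : X i j * X i j ≤ ∑ i, X i j * X i j :=
    Finset.single_le_sum (f := fun i => X i j * X i j)
      (fun i _ => mul_self_nonneg _) (Finset.mem_univ i)
  rw [sum_sq_of_mem hX] at h
  nlinarith

/-- Entries lie in `[0, 1]`, so squares are at most entries; if all were below `1 / n`, the squares
could not sum to 1. -/
theorem exists_large_entry {X : Matrix (Fin n) (Fin k) ℝ} (hX : X ∈ obliquePlus n k)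
    (j : Fin k) : ∃ i, 1 / (n : ℝ) ≤ X i j := by
  by_contra! h
  have hsum := sum_sq_of_mem hX j
  rcases Nat.eq_zero_or_pos n with rfl | hn
  · simp at hsum
  have : NeZero n := ⟨hn.ne'⟩
  have h1 : ∑ i, X i j * X i j < ∑ _i : Fin n, 1 / (n : ℝ) := by
    apply Finset.sum_lt_sum_of_nonempty Finset.univ_nonempty
    intro i _
    nlinarith [h i, hX.2 i j, entry_le_one hX i j]
  rw [hsum] at h1
  simp at h1

/-- The weighted sum of the inner products of column `j` with the other columns. -/
noncomputable def overlap (M : Matrix (Fin k) (Fin k) ℝ) (X : Matrix (Fin n) (Fin k) ℝ)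
    (j : Fin k) : ℝ :=
  ∑ l ∈ Finset.univ.erase j, (Xᵀ * X) j l * M l j

theorem transpose_mul_self_nonneg {X : Matrix (Fin n) (Fin k) ℝ} (hX : X ∈ obliquePlus n k)
    (j l : Fin k) : 0 ≤ (Xᵀ * X) j l := by
  rw [Matrix.mul_apply]
  exact Finset.sum_nonneg fun i _ => mul_nonneg (hX.2 i j) (hX.2 i l)

theorem diag_transpose_mul_mul {X : Matrix (Fin n) (Fin k) ℝ} (hX : X ∈ obliquePlus n k)
    (M : Matrix (Fin k) (Fin k) ℝ) (j : Fin k) :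
    (Xᵀ * (X * M)) j j = M j j + overlap M X j := by
  have h : (Xᵀ * X) j j = 1 := by
    rw [Matrix.mul_apply]
    exact sum_sq_of_mem hX j
  rw [← Matrix.mul_assoc, Matrix.mul_apply, ← Finset.add_sum_erase _ _ (Finset.mem_univ j), h,
    one_mul, overlap]

theorem overlap_nonneg {X : Matrix (Fin n) (Fin k) ℝ} (hX : X ∈ obliquePlus n k)
    {M : Matrix (Fin k) (Fin k) ℝ} (hM : ∀ i j, 0 < M i j) (j : Fin k) : 0 ≤ overlap M X j :=
  Finset.sum_nonneg fun l _ => mul_nonneg (transpose_mul_self_nonneg hX j l) (hM l j).le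

theorem trace_gram {V : Matrix (Fin k) (Fin r) ℝ} (hV : AdmissibleV V) :
    (V * Vᵀ).trace = 1 := by
  have h := norm_mul_sq V (1 : Matrix (Fin k) (Fin k) ℝ)
  rw [Matrix.one_mul, Matrix.one_mul, hV.1, inn, Matrix.transpose_one, Matrix.one_mul] at h
  rw [← h]
  norm_num

theorem inn_mul_gram {V : Matrix (Fin k) (Fin r) ℝ} (hV : AdmissibleV V)
    {X : Matrix (Fin n) (Fin k) ℝ} (hX : X ∈ obliquePlus n k) :
    inn X (X * (V * Vᵀ)) = 1 + ∑ j, overlap (V * Vᵀ) X j := by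
  rw [← trace_gram hV, inn, Matrix.trace, Matrix.trace, ← Finset.sum_add_distrib]
  exact Finset.sum_congr rfl fun j _ => diag_transpose_mul_mul hX _ j

theorem one_le_inn_mul_gram {V : Matrix (Fin k) (Fin r) ℝ} (hV : AdmissibleV V)
    {X : Matrix (Fin n) (Fin k) ℝ} (hX : X ∈ obliquePlus n k) :
    1 ≤ inn X (X * (V * Vᵀ)) := by
  rw [inn_mul_gram hV hX]
  linarith [Finset.sum_nonneg fun j (_ : j ∈ Finset.univ) => overlap_nonneg hX hV.2 j]

/-! ### Consequences of the weak second-order conditions -/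

theorem rgrad_nonneg {h : Matrix (Fin n) (Fin k) ℝ → ℝ} {X : Matrix (Fin n) (Fin k) ℝ}
    (hX : WSOC h X) (i : Fin n) (j : Fin k) : 0 ≤ rgrad h X i j := by
  have h1 := congrFun (congrFun hX.2.1 i) j
  simp only [minMat, Matrix.of_apply, Matrix.zero_apply] at h1
  exact h1 ▸ min_le_right _ _

theorem rgrad_eq_zero {h : Matrix (Fin n) (Fin k) ℝ → ℝ} {X : Matrix (Fin n) (Fin k) ℝ}
    (hX : WSOC h X) {i : Fin n} {j : Fin k} (hij : X i j ≠ 0) : rgrad h X i j = 0 := by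
  have h1 := congrFun (congrFun hX.2.1 i) j
  simp only [minMat, Matrix.of_apply, Matrix.zero_apply] at h1
  rcases min_choice (X i j) (rgrad h X i j) with h2 | h2
  · exact absurd (h2.symm.trans h1) hij
  · exact h2.symm.trans h1

theorem egrad_apply_of_ne_zero {h : Matrix (Fin n) (Fin k) ℝ → ℝ}
    {X : Matrix (Fin n) (Fin k) ℝ} (hX : WSOC h X) {i : Fin n} {j : Fin k} (hij : X i j ≠ 0) :
    egrad h X i j = X i j * (Xᵀ * egrad h X) j j := by
  have := rgrad_eq_zero hX hij
  rw [rgrad, Matrix.sub_apply, mul_diagPart_apply] at this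
  linarith

theorem inn_rgrad {h : Matrix (Fin n) (Fin k) ℝ → ℝ} {X D : Matrix (Fin n) (Fin k) ℝ}
    (hD : ∀ j, X.col j ⬝ᵥ D.col j = 0) : inn (rgrad h X) D = inn (egrad h X) D := by
  rw [rgrad, inn_sub_left, sub_eq_self, inn_eq_sum, Finset.sum_comm]
  refine Finset.sum_eq_zero fun j _ => ?_
  have := hD j
  rw [col_dotProduct_col] at this
  calc _ = (Xᵀ * egrad h X) j j * ∑ i, X i j * D i j := by
        rw [Finset.mul_sum]
        exact Finset.sum_congr rfl fun i _ => by rw [mul_diagPart_apply]; ring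
    _ = 0 := by rw [this, mul_zero]

theorem inn_egrad_eq_zero {h : Matrix (Fin n) (Fin k) ℝ → ℝ} {X D : Matrix (Fin n) (Fin k) ℝ}
    (hX : WSOC h X) (hD : ∀ j, X.col j ⬝ᵥ D.col j = 0) (hD0 : ∀ i j, X i j = 0 → D i j = 0) :
    inn (egrad h X) D = 0 := by
  rw [← inn_rgrad hD, inn_eq_sum]
  refine Finset.sum_eq_zero fun i _ => Finset.sum_eq_zero fun j _ => ?_
  by_cases hij : X i j = 0
  · rw [hD0 i j hij, mul_zero]
  · rw [rgrad_eq_zero hX hij, zero_mul]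

theorem inn_egrad_nonneg {h : Matrix (Fin n) (Fin k) ℝ → ℝ} {X D : Matrix (Fin n) (Fin k) ℝ}
    (hX : WSOC h X) (hD : ∀ j, X.col j ⬝ᵥ D.col j = 0) (hD0 : ∀ i j, X i j = 0 → 0 ≤ D i j) :
    0 ≤ inn (egrad h X) D := by
  rw [← inn_rgrad hD, inn_eq_sum]
  refine Finset.sum_nonneg fun i _ => Finset.sum_nonneg fun j _ => ?_
  by_cases hij : X i j = 0
  · exact mul_nonneg (rgrad_nonneg hX i j) (hD0 i j hij)
  · rw [rgrad_eq_zero hX hij, zero_mul]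

theorem inn_add_right (A B C : Matrix (Fin n) (Fin k) ℝ) :
    inn C (A + B) = inn C A + inn C B := by
  simp [inn, Matrix.mul_add]

theorem inn_sub_right (A B C : Matrix (Fin n) (Fin k) ℝ) :
    inn C (A - B) = inn C A - inn C B := by
  simp [inn, Matrix.mul_sub]

theorem inn_smul_right (c : ℝ) (A C : Matrix (Fin n) (Fin k) ℝ) :
    inn C (c • A) = c * inn C A := by
  simp [inn]

/-- The curvature of `f` along `D` in the Riemannian sense. -/
noncomputable def curv (f : Matrix (Fin n) (Fin k) ℝ → ℝ) (X D : Matrix (Fin n) (Fin k) ℝ) : ℝ :=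
  inn D (ehess f X D) - inn D (D * diagPart (Xᵀ * egrad f X))

theorem diagPart_add (A B : Matrix (Fin k) (Fin k) ℝ) :
    diagPart (A + B) = diagPart A + diagPart B := by
  simp [diagPart]

theorem diagPart_smul (c : ℝ) (B : Matrix (Fin k) (Fin k) ℝ) :
    diagPart (c • B) = c • diagPart B := by
  simp [diagPart, Matrix.diagonal_smul]

theorem inn_mul_diagPart_overlap_le {X D : Matrix (Fin n) (Fin k) ℝ} (hX : X ∈ obliquePlus n k)
    {M : Matrix (Fin k) (Fin k) ℝ} (hM : ∀ i j, 0 < M i j) :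
    inn D (D * diagPart M) ≤ inn D (D * diagPart (Xᵀ * (X * M))) := by
  rw [inn_eq_sum, inn_eq_sum]
  refine Finset.sum_le_sum fun i _ => Finset.sum_le_sum fun j _ => ?_
  rw [mul_diagPart_apply, mul_diagPart_apply, diag_transpose_mul_mul hX]
  nlinarith [mul_nonneg (overlap_nonneg hX hM j) (mul_self_nonneg (D i j))]

/-- Bounds the penalty Hessian by quantities free of `pen''`. Nonnegative overlaps allow `Xᵀ * (X *
M)` to be replaced by `M` on the diagonal, and the rank-one `pen''` term is controlled through the
first-order condition. -/
theorem curv_add_nonneg {f : Matrix (Fin n) (Fin k) ℝ → ℝ} (hf : ContDiff ℝ 2 f)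
    {V : Matrix (Fin k) (Fin r) ℝ} (hV : AdmissibleV V) {σ p q ε : ℝ} (hσ : 0 < σ)
    (hp : 0 < p) (hp1 : p ≤ 1) (hq : 0 < q) {X : Matrix (Fin n) (Fin k) ℝ}
    (hb : 0 < inn X (X * (V * Vᵀ)) ^ (q / 2) - 1 + ε)
    (hX : WSOC (penalty f V σ p q ε) X) {β : ℝ}
    (hβ : β = σ * pen' p q ε (inn X (X * (V * Vᵀ)))) {D : Matrix (Fin n) (Fin k) ℝ}
    (hD : ∀ j, X.col j ⬝ᵥ D.col j = 0) (hD0 : ∀ i j, X i j = 0 → D i j = 0) :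
    0 ≤ curv f X D + q / 2 * (inn (egrad f X) D ^ 2 / β) +
      2 * β * inn D (D * (V * Vᵀ - diagPart (V * Vᵀ))) := by
  have hs1 := one_le_inn_mul_gram hV hX.1
  have hs : 0 < inn X (X * (V * Vᵀ)) := by linarith
  have hg := egrad_penalty hf V σ p q ε hs (Or.inl hb.ne')
  have h1 := inn_egrad_eq_zero hX hD hD0
  have h2 := hX.2.2 D hD hD0
  have hle := inn_mul_diagPart_overlap_le (D := D) hX.1 hV.2
  have hp'' := pen''_le hp hp1 hq hs1 hb
  have hβ0 : 0 < β := hβ ▸ mul_pos hσ (pen'_pos hp hq hs hb)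
  rw [rhess, ehess_penalty hf V σ p q ε hs hb.ne', hg] at h2
  rw [hg] at h1
  set M := V * Vᵀ
  set P2 := pen'' p q ε (inn X (X * M))
  rw [← hβ] at h1 h2
  simp only [inn_add_left, inn_smul_left, inn_add_right, inn_smul_right, inn_sub_right,
    Matrix.mul_add, Matrix.mul_smul, diagPart_add, diagPart_smul, inn_comm D (X * M)] at h1 h2
  rw [Matrix.mul_sub, inn_sub_right, curv]
  set y := inn (X * M) D
  set z := inn (egrad f X) D
  -- Stationarity along `D` makes `y` of size `1 / β`, so `β * y ^ 2` remains bounded.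
  have hz : z = -(2 * β * y) := by linarith
  have hz2 : z ^ 2 / β = 4 * β * y ^ 2 := by
    rw [hz]
    field_simp
    ring
  rw [hz2]
  have h3 : σ * P2 ≤ q / 2 * β := by
    calc σ * P2 ≤ σ * (q / 2 * pen' p q ε (inn X (X * M))) := by gcongr
      _ = q / 2 * β := by rw [hβ]; ring
  have h4 : 4 * (σ * P2) * y * y ≤ 4 * (q / 2 * β) * y ^ 2 := by
    nlinarith [mul_le_mul_of_nonneg_right h3 (sq_nonneg y)]
  have h5 := mul_le_mul_of_nonneg_left hle hβ0.le
  linarith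

/-- If `X i l ≠ 0`, the terms `X i l * M l l` cancel in the first-order equation at `(i, l)`. The
large entry then leaves at least `2 * β * m / n` on the left, against at most `β * m / n` from the
overlap and `(n + 1) * C` from `A`. -/
theorem eq_zero_of_large_entry {M : Matrix (Fin k) (Fin k) ℝ} {m C β : ℝ} (hm : 0 < m)
    (hM : ∀ i j, m ≤ M i j) {X A : Matrix (Fin n) (Fin k) ℝ} (hX : X ∈ obliquePlus n k)
    (hA : ∀ i j, |A i j| ≤ C) (hβ : 0 < β)
    (hfirst : ∀ i j, X i j ≠ 0 →
      A i j + 2 * β * (X * M) i j = X i j * ((Xᵀ * A) j j + 2 * β * (Xᵀ * (X * M)) j j))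
    (hw : ∀ j, overlap M X j ≤ m / (2 * n)) (hlarge : (n + 1) * C < β * (m / n))
    {i : Fin n} {j l : Fin k} (hjl : j ≠ l) (hij : 1 / (n : ℝ) ≤ X i j) : X i l = 0 := by
  by_contra hil
  have hf := hfirst i l hil
  rw [diag_transpose_mul_mul hX] at hf
  have hn : 0 < (n : ℝ) := by exact_mod_cast i.pos
  have hM0 : ∀ i j, 0 < M i j := fun i j => hm.trans_le (hM i j)
  have h1 : X i l * M l l + X i j * M j l ≤ (X * M) i l := by
    rw [Matrix.mul_apply, ← Finset.add_sum_erase _ _ (Finset.mem_univ l)]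
    gcongr
    exact Finset.single_le_sum (f := fun x => X i x * M x l)
      (fun x _ => mul_nonneg (hX.2 i x) (hM0 x l).le) (by simp [hjl])
  have h2 : (Xᵀ * A) l l ≤ n * C := by
    rw [Matrix.mul_apply]
    calc ∑ x, Xᵀ l x * A x l ≤ ∑ _x : Fin n, C := by
          refine Finset.sum_le_sum fun x _ => ?_
          have := (abs_le.1 (hA x l))
          have h0 := hX.2 x l
          have h1 := entry_le_one hX x l
          rw [Matrix.transpose_apply]
          nlinarith [abs_nonneg (A x l), hA x l]
      _ = n * C := by simp
  have hC : 0 ≤ C := (abs_nonneg _).trans (hA i l)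
  have h0 := hX.2 i l
  have h1' := entry_le_one hX i l
  have h3 : X i l * (Xᵀ * A) l l ≤ n * C := by
    calc X i l * (Xᵀ * A) l l ≤ X i l * (n * C) := by gcongr
      _ ≤ 1 * (n * C) := by gcongr
      _ = n * C := one_mul _
  have h4 : X i l * overlap M X l ≤ m / (2 * n) := by
    calc X i l * overlap M X l ≤ 1 * overlap M X l := by
          gcongr
          exact overlap_nonneg hX hM0 l
      _ ≤ m / (2 * n) := by rw [one_mul]; exact hw l
  have h5 : m / n ≤ X i j * M j l := by
    calc m / n = 1 / n * m := by ring
      _ ≤ X i j * M j l := mul_le_mul hij (hM j l) hm.le (hX.2 i j)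
  have h6 : m / (2 * n) = m / n / 2 := by ring
  have h7 := (abs_le.1 (hA i l)).1
  have h8 : β * (X i l * M l l + m / n) ≤ β * (X * M) i l := by gcongr; linarith
  have h9 : β * (X i l * overlap M X l) ≤ β * (m / n / 2) := by gcongr; linarith
  nlinarith

/-! ### The exchange direction -/

/-- The direction that exchanges mass between the columns `j` and `l` in row `i`, corrected in the
rows `i₀` and `i₁`. -/
def exchange (i i₀ i₁ : Fin n) (j l : Fin k) (a b : ℝ) : Matrix (Fin n) (Fin k) ℝ :=
  Matrix.single i j 1 - Matrix.single i l 1 - Matrix.single i₀ j a + Matrix.single i₁ l b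

theorem inn_single_left (A : Matrix (Fin n) (Fin k) ℝ) (i : Fin n) (j : Fin k) (c : ℝ) :
    inn (Matrix.single i j c) A = c * A i j := by
  have : Matrix.single i j c = c • Matrix.single i j (1 : ℝ) := by simp
  rw [this, inn_smul_left, inn_comm, inn_single]

/-- Distinct rows do not interact and `N` has zero diagonal, so only the two opposite entries in row
`i` contribute; the corrections are free. -/
theorem inn_exchange {i i₀ i₁ : Fin n} {j l : Fin k} (h0 : i ≠ i₀) (h1 : i ≠ i₁) (h01 : i₀ ≠ i₁)
    (a b : ℝ) {N : Matrix (Fin k) (Fin k) ℝ} (hN : ∀ j, N j j = 0) :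
    inn (exchange i i₀ i₁ j l a b) (exchange i i₀ i₁ j l a b * N) = -(N j l + N l j) := by
  simp only [exchange, inn_add_left, inn_sub_left, inn_single_left, Matrix.add_mul, Matrix.sub_mul,
    Matrix.add_apply, Matrix.sub_apply, Matrix.single_mul_apply_same, hN,
    Matrix.single_mul_apply_of_ne _ _ _ _ _ h0, Matrix.single_mul_apply_of_ne _ _ _ _ _ h1,
    Matrix.single_mul_apply_of_ne _ _ _ _ _ h01, Matrix.single_mul_apply_of_ne _ _ _ _ _ h0.symm,
    Matrix.single_mul_apply_of_ne _ _ _ _ _ h1.symm,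
    Matrix.single_mul_apply_of_ne _ _ _ _ _ h01.symm]
  ring

theorem exchange_apply_eq_zero {X : Matrix (Fin n) (Fin k) ℝ} {i i₀ i₁ : Fin n} {j l : Fin k}
    (hij : X i j ≠ 0) (hil : X i l ≠ 0) (h0 : X i₀ j ≠ 0) (h1 : X i₁ l ≠ 0) (a b : ℝ)
    (x : Fin n) (y : Fin k) (hxy : X x y = 0) : exchange i i₀ i₁ j l a b x y = 0 := by
  have key : ∀ (u : Fin n) (v : Fin k) (c : ℝ), X u v ≠ 0 → Matrix.single u v c x y = 0 := by
    intro u v c huv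
    apply Matrix.single_apply_of_ne
    rintro ⟨rfl, rfl⟩
    exact huv hxy
  simp [exchange, key, hij, hil, h0, h1]

theorem exchange_tangent {X : Matrix (Fin n) (Fin k) ℝ} {i i₀ i₁ : Fin n} {j l : Fin k}
    (h0 : X i₀ j ≠ 0) (h1 : X i₁ l ≠ 0) (y : Fin k) :
    X.col y ⬝ᵥ (exchange i i₀ i₁ j l (X i j / X i₀ j) (X i l / X i₁ l)).col y = 0 := by
  have key : ∀ (u : Fin n) (v : Fin k) (c : ℝ),
      ∑ x, X x y * Matrix.single u v c x y = if v = y then X u y * c else 0 := by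
    intro u v c
    simp only [Matrix.single_apply, mul_ite, mul_zero, ite_and]
    simp
  simp only [col_dotProduct_col, exchange, Matrix.add_apply, Matrix.sub_apply, mul_add, mul_sub,
    Finset.sum_add_distrib, Finset.sum_sub_distrib, key]
  by_cases hj : j = y <;> by_cases hl : l = y <;> simp [hj, hl] <;> subst_vars <;> field_simp <;>
    ring

theorem norm_sq_eq (X : Matrix (Fin n) (Fin k) ℝ) : ‖X‖ ^ 2 = inn X X := by
  simpa using norm_mul_sq (1 : Matrix (Fin k) (Fin k) ℝ) X

theorem norm_single (i : Fin n) (j : Fin k) (c : ℝ) : ‖Matrix.single i j c‖ = |c| := by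
  rw [← sq_eq_sq₀ (norm_nonneg _) (abs_nonneg c), norm_sq_eq, inn_single_left, sq_abs]
  simp [sq]

theorem norm_exchange_le (i i₀ i₁ : Fin n) (j l : Fin k) (a b : ℝ) :
    ‖exchange i i₀ i₁ j l a b‖ ≤ 2 + |a| + |b| := by
  unfold exchange
  refine (norm_add_le _ _).trans ?_
  rw [norm_single]
  gcongr
  refine (norm_sub_le _ _).trans ?_
  rw [norm_single]
  gcongr
  refine (norm_sub_le _ _).trans ?_
  rw [norm_single, norm_single]
  norm_num

/-! ### Uniform bounds by compactness -/

theorem isCompact_obliquePlus : IsCompact (obliquePlus n k) := by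
  refine Metric.isCompact_of_isClosed_isBounded ?_ ?_
  · have : obliquePlus n k = (⋂ j, {X | ∑ i, X i j * X i j = 1}) ∩ ⋂ i, ⋂ j, {X | 0 ≤ X i j} := by
      ext X
      simp [obliquePlus, col_dotProduct_col]
    rw [this]
    refine (isClosed_iInter fun j => ?_).inter (isClosed_iInter fun i => isClosed_iInter fun j => ?_)
    · refine isClosed_eq ?_ continuous_const
      fun_prop
    · refine isClosed_le continuous_const ?_
      fun_prop
  · rw [isBounded_iff_forall_norm_le]
    refine ⟨k + 1, fun X hX => ?_⟩
    apply abs_le_of_sq_le_sq' _ (by positivity) |>.2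
    rw [norm_sq_eq, inn_eq_sum, Finset.sum_comm]
    simp only [sum_sq_of_mem hX]
    simp
    nlinarith [(Nat.cast_nonneg k : (0 : ℝ) ≤ k)]

theorem continuous_curv {f : Matrix (Fin n) (Fin k) ℝ → ℝ} (hf : ContDiff ℝ 2 f) :
    Continuous fun z : Matrix (Fin n) (Fin k) ℝ × Matrix (Fin n) (Fin k) ℝ => curv f z.1 z.2 := by
  have hg := contDiff_egrad hf
  have h1 : Continuous fun z : Matrix (Fin n) (Fin k) ℝ × Matrix (Fin n) (Fin k) ℝ =>
      ehess f z.1 z.2 :=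
    ((hg.continuous_fderiv (by norm_num)).comp continuous_fst).clm_apply continuous_snd
  have h2 : Continuous fun z : Matrix (Fin n) (Fin k) ℝ × Matrix (Fin n) (Fin k) ℝ =>
      z.2 * diagPart (z.1ᵀ * egrad f z.1) := by
    have := hg.continuous
    unfold diagPart
    fun_prop
  exact (continuous_inn.comp (continuous_snd.prodMk h1)).sub
    (continuous_inn.comp (continuous_snd.prodMk h2))

theorem exists_bound {f : Matrix (Fin n) (Fin k) ℝ → ℝ} (hf : ContDiff ℝ 2 f) (R : ℝ) :
    ∃ C, 0 ≤ C ∧ ∀ X ∈ obliquePlus n k, (∀ i j, |egrad f X i j| ≤ C) ∧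
      ∀ D : Matrix (Fin n) (Fin k) ℝ, ‖D‖ ≤ R → curv f X D ≤ C ∧ |inn (egrad f X) D| ≤ C := by
  -- Radius at least 1 keeps the matrix units in the ball, so one bound also covers the entries of
  -- the gradient.
  have hK : IsCompact ((obliquePlus n k) ×ˢ
      Metric.closedBall (0 : Matrix (Fin n) (Fin k) ℝ) (max R 1)) :=
    isCompact_obliquePlus.prod (isCompact_closedBall _ _)
  have hg := (contDiff_egrad hf).continuous
  obtain ⟨C1, hC1⟩ := hK.exists_bound_of_continuousOn (continuous_curv hf).continuousOn
  obtain ⟨C2, hC2⟩ := hK.exists_bound_of_continuousOn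
    (continuous_inn.comp ((hg.comp continuous_fst).prodMk continuous_snd)).continuousOn
  refine ⟨max (max C1 C2) 0, le_max_right _ _, fun X hX => ⟨fun i j => ?_, fun D hD => ⟨?_, ?_⟩⟩⟩
  · have := hC2 (X, Matrix.single i j 1) ⟨hX, by simp [norm_single]⟩
    simp only [Function.comp, inn_single, Real.norm_eq_abs] at this
    exact this.trans ((le_max_right _ _).trans (le_max_left _ _))
  · have := hC1 (X, D) ⟨hX, by simp [hD]⟩
    exact (le_abs_self _).trans (this.trans ((le_max_left _ _).trans (le_max_left _ _)))
  · have := hC2 (X, D) ⟨hX, by simp [hD]⟩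
    exact this.trans ((le_max_right _ _).trans (le_max_left _ _))

theorem exists_entry_lower_bound {M : Matrix (Fin k) (Fin k) ℝ} (hM : ∀ i j, 0 < M i j) :
    ∃ m, 0 < m ∧ ∀ i j, m ≤ M i j := by
  rcases isEmpty_or_nonempty (Fin k × Fin k) with h | h
  · exact ⟨1, one_pos, fun i j => (h.false (i, j)).elim⟩
  · obtain ⟨z, hz⟩ := Finite.exists_min fun z : Fin k × Fin k => M z.1 z.2
    exact ⟨M z.1 z.2, hM _ _, fun i j => hz (i, j)⟩

/-! ### Exactness of the penalty -/

theorem inn_mul_gram_le_one {V : Matrix (Fin k) (Fin r) ℝ} (hV : AdmissibleV V)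
    {X : Matrix (Fin n) (Fin k) ℝ} (hX : X ∈ obliquePlus n k)
    (h : ∀ i j l, j ≠ l → X i j ≠ 0 → X i l = 0) : inn X (X * (V * Vᵀ)) ≤ 1 := by
  rw [inn_mul_gram hV hX, Finset.sum_eq_zero, add_zero]
  intro j _
  refine Finset.sum_eq_zero fun l hl => ?_
  rw [Matrix.mul_apply, Finset.sum_eq_zero, zero_mul]
  intro i _
  rw [Matrix.transpose_apply]
  by_cases hij : X i j = 0
  · rw [hij, zero_mul]
  · rw [h i j l (Finset.ne_of_mem_erase hl).symm hij, mul_zero]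

/-- For a large effective penalty parameter, a nearly feasible point satisfying the weak
second-order conditions of the penalty subproblem is feasible. -/
theorem exists_exactness_threshold {f : Matrix (Fin n) (Fin k) ℝ → ℝ} (hf : ContDiff ℝ 2 f)
    {V : Matrix (Fin k) (Fin r) ℝ} (hV : AdmissibleV V) {q : ℝ} (hq : 0 < q) :
    ∃ β₀ δ : ℝ, 0 < δ ∧ ∀ (σ p ε : ℝ) (X : Matrix (Fin n) (Fin k) ℝ), 0 < σ → 0 < p → p ≤ 1 →
      0 < inn X (X * (V * Vᵀ)) ^ (q / 2) - 1 + ε → WSOC (penalty f V σ p q ε) X →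
      β₀ ≤ σ * pen' p q ε (inn X (X * (V * Vᵀ))) → inn X (X * (V * Vᵀ)) ≤ 1 + δ →
      inn X (X * (V * Vᵀ)) ≤ 1 := by
  obtain ⟨m, hm, hmM⟩ := exists_entry_lower_bound hV.2
  -- The radius bounds the exchange direction, whose correction ratios are at most `n` since their
  -- denominators are at least `1 / n`.
  obtain ⟨C, hC0, hC⟩ := exists_bound hf (2 + n + n)
  -- The summands of `β₀` serve positivity with strictness, the large-entry argument, and the final
  -- curvature contradiction. In `δ`, `n + 1` keeps the denominator positive even for `n = 0`.
  refine ⟨1 + (n + 1) * C * n / m + (C + q / 2 * C ^ 2) / (4 * m), m / (2 * (n + 1)),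
    by positivity, ?_⟩
  intro σ p ε X hσ hp hp1 hb hX hβ hδ
  have hOB := hX.1
  obtain ⟨hA, hCD⟩ := hC X hOB
  set M := V * Vᵀ with hM
  set β := σ * pen' p q ε (inn X (X * M)) with hβdef
  refine inn_mul_gram_le_one hV hOB fun i j l hjl hij => ?_
  by_contra hil
  have hn : 0 < (n : ℝ) := by exact_mod_cast i.pos
  have t1 : 0 ≤ (n + 1) * C * n / m := by positivity
  have t2 : 0 ≤ (C + q / 2 * C ^ 2) / (4 * m) := by positivity
  have hβ1 : 1 ≤ β := by linarith
  have hβ0 : 0 < β := by linarith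
  have hs := one_le_inn_mul_gram hV hOB
  have hfirst : ∀ i j, X i j ≠ 0 → egrad f X i j + 2 * β * (X * M) i j =
      X i j * ((Xᵀ * egrad f X) j j + 2 * β * (Xᵀ * (X * M)) j j) := by
    intro i j hij
    have := egrad_apply_of_ne_zero hX hij
    rw [egrad_penalty hf V σ p q ε (by linarith) (Or.inl hb.ne'), ← hM, ← hβdef] at this
    simpa [Matrix.mul_add] using this
  have hw : ∀ j, overlap M X j ≤ m / (2 * n) := by
    intro j
    have h1 : overlap M X j ≤ ∑ j, overlap M X j :=
      Finset.single_le_sum (fun j _ => overlap_nonneg hOB hV.2 j) (Finset.mem_univ j)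
    have h2 := inn_mul_gram hV hOB
    have h3 : m / (2 * ((n : ℝ) + 1)) ≤ m / (2 * n) := by gcongr; linarith
    linarith
  have hlarge : (n + 1) * C < β * (m / n) := by
    have : (n + 1) * C * n / m < β := by linarith
    rw [div_lt_iff₀ hm] at this
    rw [← mul_div_assoc, lt_div_iff₀ hn]
    exact this
  have key := fun (i : Fin n) (j l : Fin k) (hjl : j ≠ l) (h : 1 / (n : ℝ) ≤ X i j) =>
    eq_zero_of_large_entry hm hmM hOB hA hβ0 hfirst hw hlarge hjl h
  have hn1 : 0 < 1 / (n : ℝ) := by positivity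
  obtain ⟨i₀, hi₀⟩ := exists_large_entry hOB j
  obtain ⟨i₁, hi₁⟩ := exists_large_entry hOB l
  have h0 : i ≠ i₀ := by
    rintro rfl
    exact hil (key i j l hjl hi₀)
  have h1 : i ≠ i₁ := by
    rintro rfl
    exact hij (key i l j hjl.symm hi₁)
  have h01 : i₀ ≠ i₁ := by
    rintro rfl
    rw [key i₀ j l hjl hi₀] at hi₁
    linarith
  have p0 : X i₀ j ≠ 0 := by linarith
  have p1 : X i₁ l ≠ 0 := by linarith
  have ratio : ∀ (x y : Fin n) (c : Fin k), 1 / (n : ℝ) ≤ X y c → |X x c / X y c| ≤ n := by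
    intro x y c h
    rw [abs_of_nonneg (div_nonneg (hOB.2 x c) (hOB.2 y c)), div_le_iff₀ (by linarith)]
    rw [div_le_iff₀ hn] at h
    linarith [entry_le_one hOB x c]
  set D := exchange i i₀ i₁ j l (X i j / X i₀ j) (X i l / X i₁ l) with hDdef
  have hDn : ‖D‖ ≤ 2 + n + n := by
    refine (norm_exchange_le _ _ _ _ _ _ _).trans ?_
    gcongr
    · exact ratio i i₀ j hi₀
    · exact ratio i i₁ l hi₁
  have hsec := curv_add_nonneg hf hV hσ hp hp1 hq hb hX hβdef (D := D)
    (exchange_tangent p0 p1) (exchange_apply_eq_zero hij hil p0 p1 _ _)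
  obtain ⟨b1, b2⟩ := hCD D hDn
  rw [hDdef, inn_exchange h0 h1 h01 _ _ (fun j => by simp [diagPart]), ← hDdef] at hsec
  have e1 : (M - diagPart M) j l = M j l := by simp [diagPart, hjl]
  have e2 : (M - diagPart M) l j = M l j := by simp [diagPart, hjl.symm]
  rw [← hM, e1, e2] at hsec
  have b3 : inn (egrad f X) D ^ 2 / β ≤ C ^ 2 := by
    rw [div_le_iff₀ hβ0]
    nlinarith [sq_le_sq' (abs_le.1 b2).1 (abs_le.1 b2).2, sq_nonneg C]
  have b4 : q / 2 * (inn (egrad f X) D ^ 2 / β) ≤ q / 2 * C ^ 2 := by gcongr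
  have b5 : C + q / 2 * C ^ 2 < β * (4 * m) := by
    rw [← div_lt_iff₀ (by positivity)]
    linarith
  have b6 : β * (2 * m) ≤ β * (M j l + M l j) := by
    gcongr
    linarith [hmM j l, hmM l j]
  linarith

/-- A base in `(0, 1]` with exponent `p - 1 ≤ 0` gives a factor at least 1, and `s ≤ 2` yields `s ^
(q / 2 - 1) ≥ 1 / 2`. -/
theorem pen'_lower_bound {p q ε s : ℝ} (hp : 0 < p) (hp1 : p ≤ 1) (hq : 0 < q) (hs : 1 ≤ s)
    (hs2 : s ≤ 2) (hb : 0 < s ^ (q / 2) - 1 + ε) (hb1 : s ^ (q / 2) - 1 + ε ≤ 1) :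
    q * p / 4 ≤ pen' p q ε s := by
  have h1 : 1 ≤ (s ^ (q / 2) - 1 + ε) ^ (p - 1) :=
    Real.one_le_rpow_of_pos_of_le_one_of_nonpos hb hb1 (by linarith)
  have h2 : 1 / 2 ≤ s ^ (q / 2 - 1) := by
    calc (1 : ℝ) / 2 ≤ 1 / s := by gcongr
      _ = s ^ (-1 : ℝ) := by rw [Real.rpow_neg_one, one_div]
      _ ≤ s ^ (q / 2 - 1) := Real.rpow_le_rpow_of_exponent_le hs (by linarith)
  calc q * p / 4 = q / 2 * (1 / 2) * p * 1 := by ring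
    _ ≤ q / 2 * s ^ (q / 2 - 1) * p * (s ^ (q / 2) - 1 + ε) ^ (p - 1) := by gcongr

theorem stiefelPlus_subset : stiefelPlus n k ⊆ obliquePlus n k := by
  intro X hX
  refine ⟨fun j => ?_, hX.2⟩
  have := congrFun (congrFun hX.1 j) j
  rw [Matrix.one_apply_eq] at this
  exact this

theorem inn_mul_gram_of_mem_stiefelPlus {V : Matrix (Fin k) (Fin r) ℝ} (hV : AdmissibleV V)
    {X : Matrix (Fin n) (Fin k) ℝ} (hX : X ∈ stiefelPlus n k) : inn X (X * (V * Vᵀ)) = 1 := by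
  rw [inn, ← Matrix.mul_assoc, hX.1, Matrix.one_mul, trace_gram hV]

/-- The gradients of `f` and of the penalty function differ by a multiple of `X * V * Vᵀ`,
orthogonal to the linearized cone. At `s = 1` the base of the power is `ε`, so differentiability
needs `0 < ε` or `1 ≤ p`. -/
theorem isStationary_of_wsoc {f : Matrix (Fin n) (Fin k) ℝ → ℝ} (hf : ContDiff ℝ 2 f)
    {V : Matrix (Fin k) (Fin r) ℝ} {σ p q ε : ℝ} (hε : 0 < ε ∨ 1 ≤ p)
    {X : Matrix (Fin n) (Fin k) ℝ} (hX : WSOC (penalty f V σ p q ε) X)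
    (hs : inn X (X * (V * Vᵀ)) = 1) : IsStationary f V X := by
  refine ⟨⟨hX.1, ?_⟩, fun D hD => ?_⟩
  · rw [← norm_mul_sq] at hs
    exact (pow_eq_one_iff_of_nonneg (norm_nonneg _) two_ne_zero).1 hs
  · have h1 := inn_egrad_nonneg hX hD.1 hD.2.1
    rw [egrad_penalty hf V σ p q ε (by rw [hs]; exact one_pos), inn_add_left, inn_smul_left,
      inn_comm (X * _), ← Matrix.mul_assoc, hD.2.2, mul_zero, add_zero] at h1
    · rw [inn_neg_left]
      linarith
    · rw [hs, Real.one_rpow]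
      exact hε.imp_left fun h => by linarith

/-! ### Parameter sequences and finite termination -/

namespace Params

theorem σ_eq (a : Params n k) (t : ℕ) : a.σ t = a.σ₀ * a.γ₂ ^ t := by
  induction t with
  | zero => simp [σ]
  | succ t ih => rw [σ, ih, pow_succ]; ring

theorem σ_pos {a : Params n k} (ha : a.Valid) (t : ℕ) : 0 < a.σ t := by
  rw [σ_eq]
  have := ha.σ₀_pos
  have := ha.one_lt_γ₂
  positivity

theorem tendsto_σ {a : Params n k} (ha : a.Valid) :
    Filter.Tendsto a.σ Filter.atTop Filter.atTop := by
  rw [funext a.σ_eq]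
  exact (tendsto_pow_atTop_atTop_of_one_lt ha.one_lt_γ₂).const_mul_atTop ha.σ₀_pos

theorem ε_eq (a : Params n k) (t : ℕ) : a.ε t = a.ε₀ * a.γ₁ ^ t := by
  induction t with
  | zero => simp [ε]
  | succ t ih => rw [ε, ih, pow_succ]; ring

theorem ε_pos_or {a : Params n k} (ha : a.Valid) (t : ℕ) : 0 < a.ε t ∨ 1 ≤ a.p := by
  refine (lt_or_ge a.p 1).imp_left fun h => ?_
  obtain ⟨h1, h2, -⟩ := ha.of_p_lt_one h
  rw [ε_eq]
  positivity

theorem ε_nonneg {a : Params n k} (ha : a.Valid) (t : ℕ) : 0 ≤ a.ε t := by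
  rcases ε_pos_or ha t with h | h
  · exact h.le
  · rw [ε_eq, (ha.of_one_le_p h).1, zero_mul]

/-- For `p < 1` each step multiplies the product by `γ₂ * γ₁ ^ p ≤ 1`, which is what the upper bound
on `γ₁` ensures; for `p = 1` or larger, `ε` vanishes. -/
theorem σ_mul_ε_rpow_le {a : Params n k} (ha : a.Valid) (t : ℕ) :
    a.σ t * a.ε t ^ a.p ≤ a.σ₀ * a.ε₀ ^ a.p := by
  rcases lt_or_ge a.p 1 with h | h
  · obtain ⟨h1, h2, h3⟩ := ha.of_p_lt_one h
    have hγ : 0 < a.γ₂ := one_pos.trans ha.one_lt_γ₂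
    have h4 : a.γ₁ ^ a.p ≤ a.γ₂⁻¹ := by
      have := Real.rpow_le_rpow h2.le h3.le ha.p_pos.le
      rwa [← Real.rpow_mul hγ.le, div_mul_cancel₀ _ ha.p_pos.ne', Real.rpow_neg_one] at this
    have h5 : a.γ₂ * a.γ₁ ^ a.p ≤ 1 := by
      calc a.γ₂ * a.γ₁ ^ a.p ≤ a.γ₂ * a.γ₂⁻¹ := by gcongr
        _ = 1 := mul_inv_cancel₀ hγ.ne'
    induction t with
    | zero => exact le_rfl
    | succ t ih =>
      have h6 : 0 ≤ a.σ t * a.ε t ^ a.p :=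
        mul_nonneg (σ_pos ha t).le (Real.rpow_nonneg (ε_nonneg ha t) _)
      calc a.σ (t + 1) * a.ε (t + 1) ^ a.p
          = (a.γ₂ * a.γ₁ ^ a.p) * (a.σ t * a.ε t ^ a.p) := by
            rw [σ, ε, Real.mul_rpow h2.le (ε_nonneg ha t)]
            ring
        _ ≤ 1 * (a.σ t * a.ε t ^ a.p) := by gcongr
        _ ≤ _ := by rwa [one_mul]
  · rw [ε_eq, (ha.of_one_le_p h).1, zero_mul, Real.zero_rpow ha.p_pos.ne', mul_zero, mul_zero]

theorem P_start_le (a : Params n k) (f : Matrix (Fin n) (Fin k) ℝ → ℝ)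
    (V : Matrix (Fin k) (Fin r) ℝ) (X : ℕ → Matrix (Fin n) (Fin k) ℝ) (t : ℕ) :
    a.P f V t (a.start f V X t) ≤ a.P f V t a.Xfeas := by
  unfold start
  split_ifs with h
  · exact le_rfl
  · exact not_lt.1 h

theorem P_Xfeas {a : Params n k} (ha : a.Valid) (f : Matrix (Fin n) (Fin k) ℝ → ℝ)
    {V : Matrix (Fin k) (Fin r) ℝ} (hV : AdmissibleV V) (t : ℕ) :
    a.P f V t a.Xfeas = f a.Xfeas + a.σ t * a.ε t ^ a.p := by
  rw [P, penalty_eq]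
  simp [inn_mul_gram_of_mem_stiefelPlus hV ha.Xfeas_mem, pen]

theorem exists_stops {a : Params n k} (ha : a.Valid) (htMax : a.tMax = ⊤) (htol : a.tolFeas = 0)
    (hp : a.p ≤ 1) {f : Matrix (Fin n) (Fin k) ℝ → ℝ} (hf : ContDiff ℝ 2 f)
    {V : Matrix (Fin k) (Fin r) ℝ} (hV : AdmissibleV V)
    {X : ℕ → Matrix (Fin n) (Fin k) ℝ} (hX : a.Generated f V X)
    (hWSOC : ∀ t, a.Executed V X t → WSOC (a.P f V t) (X t)) : ∃ t, a.Stops V X t := by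
  by_contra! hns
  have hex : ∀ t, a.Executed V X t := fun t => ⟨by simp [htMax], fun s _ => hns s⟩
  have hp0 := ha.p_pos
  have hq := ha.q_pos
  obtain ⟨β₀, δ, hδ, hthr⟩ := exists_exactness_threshold hf hV hq
  obtain ⟨B, hB⟩ := isCompact_obliquePlus.exists_bound_of_continuousOn
    (hf.continuous.continuousOn (s := obliquePlus n k))
  set K := 2 * B + a.σ₀ * a.ε₀ ^ a.p with hK
  -- The first bound keeps the base at most 1 for `pen'_lower_bound`; the second forces both `s ≤ 1
  -- + δ` and `s ≤ 2`.
  set δ' := min 1 ((1 + min δ 1) ^ (a.q / 2) - 1) with hδ'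
  have hδ1 : 1 < 1 + min δ 1 := by simp [hδ]
  have hδ'0 : 0 < δ' := lt_min one_pos (by linarith [Real.one_lt_rpow hδ1 (half_pos hq)])
  obtain ⟨t, ht⟩ := ((tendsto_σ ha).eventually_ge_atTop
    (max (K / δ' ^ a.p) (β₀ / (a.q * a.p / 4)))).exists
  obtain ⟨ht1, ht2⟩ := max_le_iff.1 ht
  have hσ := σ_pos ha t
  have hmem := (hX t (hex t)).1
  have hs1 : 1 < inn (X t) (X t * (V * Vᵀ)) := by
    have := hns t
    rw [Stops, htol, norm_mul_sq] at this
    linarith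
  set s := inn (X t) (X t * (V * Vᵀ)) with hs
  have hpow : 1 < s ^ (a.q / 2) := Real.one_lt_rpow hs1 (half_pos hq)
  have hε := ε_nonneg ha t
  have hb : 0 < s ^ (a.q / 2) - 1 + a.ε t := by linarith
  have hdesc : f (X t) + a.σ t * (s ^ (a.q / 2) - 1 + a.ε t) ^ a.p ≤
      f a.Xfeas + a.σ t * a.ε t ^ a.p := by
    have := ((hX t (hex t)).2.2.trans (a.P_start_le f V X t)).trans_eq (P_Xfeas ha f hV t)
    rwa [P, penalty_eq] at this
  have hK' : (s ^ (a.q / 2) - 1 + a.ε t) ^ a.p * a.σ t ≤ K := by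
    have h1 := (abs_le.1 (hB _ hmem)).1
    have h2 := (abs_le.1 (hB _ (stiefelPlus_subset ha.Xfeas_mem))).2
    have h3 := σ_mul_ε_rpow_le ha t
    linarith
  have hb' : s ^ (a.q / 2) - 1 + a.ε t ≤ δ' := by
    rw [← Real.rpow_le_rpow_iff hb.le hδ'0.le hp0]
    rw [div_le_iff₀ (by positivity)] at ht1
    nlinarith
  have hsδ : s ≤ 1 + min δ 1 := by
    rw [← Real.rpow_le_rpow_iff (by linarith) (by linarith) (half_pos hq)]
    linarith [min_le_right (1 : ℝ) ((1 + min δ 1) ^ (a.q / 2) - 1)]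
  have hpen := pen'_lower_bound hp0 hp hq hs1.le (by linarith [min_le_right δ 1]) hb
    (hb'.trans (min_le_left _ _))
  have hβ : β₀ ≤ a.σ t * pen' a.p a.q (a.ε t) s := by
    rw [div_le_iff₀ (by positivity)] at ht2
    exact ht2.trans (by gcongr)
  have := hthr _ _ _ _ hσ hp0 hp hb (hWSOC t (hex t)) hβ (by linarith [min_le_left δ 1])
  linarith

end Params

end EP4Orth

theorem mainTheorem6 {n k r : ℕ} (hk : 1 ≤ k) (hkn : k ≤ n) (hr : 1 ≤ r) (hrk : r ≤ k)
    (f : Matrix (Fin n) (Fin k) ℝ → ℝ) (hf : ContDiff ℝ 2 f)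
    (V : Matrix (Fin k) (Fin r) ℝ) (hV : EP4Orth.AdmissibleV V)
    (a : EP4Orth.Params n k) (ha : a.Valid)
    (htMax : a.tMax = ⊤) (htol : a.tolFeas = 0) (hp : a.p ≤ 1)
    (hgrad₀ : a.εgrad₀ = 0) (hgradMin : a.εgradMin = 0)
    (X : ℕ → Matrix (Fin n) (Fin k) ℝ) (hX : a.Generated f V X)
    (hWSOC : ∀ t, a.Executed V X t → EP4Orth.WSOC (a.P f V t) (X t)) :
    ∃ t : ℕ, a.Executed V X t ∧ a.Stops V X t ∧ EP4Orth.IsStationary f V (X t) := by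
  classical
  have hst := EP4Orth.Params.exists_stops ha htMax htol hp hf hV hX hWSOC
  have hex : a.Executed V X (Nat.find hst) :=
    ⟨by simp [htMax], fun s hs => Nat.find_min hst hs⟩
  refine ⟨_, hex, Nat.find_spec hst,
    EP4Orth.isStationary_of_wsoc hf (EP4Orth.Params.ε_pos_or ha _) (hWSOC _ hex) ?_⟩
  have h := Nat.find_spec hst
  rw [EP4Orth.Params.Stops, htol, EP4Orth.norm_mul_sq] at h
  exact le_antisymm (by linarith) (EP4Orth.one_le_inn_mul_gram hV (hX _ hex).1)
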